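/- **Proposition (Symplectic covariance of Hagedorn ladder operators).** Let $d\in\mathbb N$, $\hbar>0$. On the Schwartz space $\mathscr S(\mathbb R^d)$ let $\hat x_jf(x)=x_jf(x)$ and $\hat p_jf=-\mathrm i\hbar\,\partial f/\partial x_j$, write $\hat z=(\hat x,\hat p)$, $J=\begin{bmatrix}0&I_d\\-I_d&0\end{bmatrix}$, and for a complex $2d\times 2d$ matrix $\mathcal X$ let $\rho(\mathcal X;\hat z)=\mathcal X^TJ\hat z$ (a $2d$-tuple of operators with domain $\mathscr S(\mathbb R^d)$). Put $$W_\hbar=\frac1{\sqrt{2\hbar}}\begin{bmatrix}\mathrm iI_d&-\mathrm iI_d\\-I_d&-I_d\end{bmatrix},$$ so that the first and the last $d$ entries of $\rho(W_\hbar;\hat z)$ are $\frac1{\sqrt{2\hbar}}(\hat x+\mathrm i\hat p)$ and $\frac1{\sqrt{2\hbar}}(\hat x-\mathrm i\hat p)$. Let $\mathsf{Sp}(2d,\mathbb R)=\{S\in\mathsf M_{2d}(\mathbb R): S^TJS=J\}$. Let $\mathsf{Mp}(2d,\mathbb R)$ be the group of unitary operators on $L^2(\mathbb R^d)$ generated by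 $$\widehat J\psi(x)=(2\pi\hbar\,\mathrm i)^{-d/2}\int e^{-\frac{\mathrm i}{\hbar}x\cdot y}\psi(y)\,dy,\qquad \widehat V_R\psi(x)=e^{\frac{\mathrm i}{2\hbar}x^TRx}\psi(x),\qquad \widehat M^m_L\psi(x)=\mathrm i^m\sqrt{|\det L|}\,\psi(Lx),$$ where $\widehat J$ is given on $\mathscr S(\mathbb R^d)$ and extended unitarily (the complex power being the principal one), $R$ runs over the real symmetric $d\times d$ matrices, $L$ over $\mathsf{GL}(d,\mathbb R)$ and $m$ over the integers with $m\pi\equiv\arg(\det L)\pmod{2\pi}$; and let $\pi_{\mathsf{Mp}}:\mathsf{Mp}(2d,\mathbb R)\to\mathsf{Sp}(2d,\mathbb R)$ be the homomorphism with $$\pi_{\mathsf{Mp}}(\widehat J)=J,\qquad \pi_{\mathsf{Mp}}(\widehat V_R)=\begin{bmatrix}I_d&0\\R&I_d\end{bmatrix},\qquad \pi_{\mathsf{Mp}}(\widehat M_L^m)=\begin{bmatrix}L^{-1}&0\\0&L^T\end{bmatrix}.$$ For $z=(q,p)\in\mathbb R^{2d}$ let $(\widehat T_zf)(x)=e^{\frac{\mathrm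 i}{\hbar}p\cdot(x-q/2)}f(x-q)$. For $S\in\mathsf{Sp}(2d,\mathbb R)$ and $z\in\mathbb R^{2d}$ define the Hagedorn lowering and raising operators $\mathscr A_j(S,z)$, $\mathscr A_j^*(S,z)$, $1\le j\le d$, by $$\begin{bmatrix}\mathscr A(S,z)\\ \mathscr A^*(S,z)\end{bmatrix}=\widehat T_z\,\widehat S\,\rho(W_\hbar;\hat z)\,\widehat S^*\,\widehat T_z^*,$$ where $\widehat S\in\mathsf{Mp}(2d,\mathbb R)$ satisfies $\pi_{\mathsf{Mp}}(\widehat S)=S$ (such $\widehat S$ exists and is unique up to sign, which is immaterial here). Then for all $\widehat S_0\in\mathsf{Mp}(2d,\mathbb R)$ with $S_0=\pi_{\mathsf{Mp}}(\widehat S_0)$, all $S\in\mathsf{Sp}(2d,\mathbb R)$, $z\in\mathbb R^{2d}$ and $j\in\{1,\dots,d\}$, $$\widehat S_0\,\mathscr A_j(S,z)\,\widehat S_0^*=\mathscr A_j(S_0S,S_0z),\qquad \widehat S_0\,\mathscr A_j^*(S,z)\,\widehat S_0^*=\mathscr A_j^*(S_0S,S_0z),$$ as operators in $L^2(\mathbb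 R^d)$, where $VAV^*$ has the domain $\{f: V^*f\in D(A)\}$ for $V$ unitary. -/

import Mathlib

open MeasureTheory Matrix SchwartzMap
open scoped FourierTransform LineDeriv ENNReal

noncomputable section

namespace Hagedorn

/-- Configuration space `ℝᵈ` with its Euclidean structure. -/
abbrev Conf (d : ℕ) : Type := EuclideanSpace ℝ (Fin d)

/-- The Hilbert space `L²(ℝᵈ)`. -/
abbrev L2 (d : ℕ) : Type := Lp ℂ 2 (volume : Measure (Conf d))

/-- The unitary operators of `L²(ℝᵈ)`; in this group the inverse is the adjoint. -/
abbrev U (d : ℕ) : Type := L2 d ≃ₗᵢ[ℂ] L2 d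

/-- Phase space `T*ℝᵈ ≅ ℝ²ᵈ`; a point is `z = (q, p)` with `q = z ∘ Sum.inl`, `p = z ∘ Sum.inr`. -/
abbrev Phase (d : ℕ) : Type := Fin d ⊕ Fin d → ℝ

/-- The real symplectic group `Sp(2d, ℝ)`. -/
abbrev Sp (d : ℕ) : Type := Matrix.symplecticGroup (Fin d) ℝ

section WeightedComposition

variable {d : ℕ}

theorem eLpNorm_weightedComp (φ : Conf d ≃ₜ Conf d) (w : Conf d → ℂ) (k : ℝ) (hk : 0 < k)
    (hwk : ∀ x, ‖w x‖ = k)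
    (hφ : (volume : Measure (Conf d)).map φ = ENNReal.ofReal ((k ^ 2)⁻¹) • volume)
    (f : Conf d → ℂ) (hf : AEStronglyMeasurable f volume) :
    eLpNorm (fun x => w x * f (φ x)) 2 volume = eLpNorm f 2 volume := by
  have h1 : eLpNorm (fun x => w x * f (φ x)) 2 volume
      = eLpNorm ((k : ℂ) • (f ∘ φ)) 2 volume := by
    apply eLpNorm_congr_norm_ae
    refine Filter.Eventually.of_forall fun x => ?_
    simp [hwk, abs_of_pos hk]
  have hfm : AEStronglyMeasurable f ((volume : Measure (Conf d)).map φ) := by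
    rw [hφ]; exact hf.smul_measure _
  have hkk : ENNReal.ofReal k * ENNReal.ofReal ((k ^ 2)⁻¹) ^ (1 / (2 : ℝ)) = 1 := by
    rw [ENNReal.ofReal_rpow_of_pos (by positivity), ← ENNReal.ofReal_mul hk.le,
      ← Real.sqrt_eq_rpow, Real.sqrt_inv, Real.sqrt_sq hk.le, mul_inv_cancel₀ hk.ne']
    simp
  have hk' : ‖(k : ℂ)‖ₑ = ENNReal.ofReal k := by
    rw [← ofReal_norm, Complex.norm_real, Real.norm_of_nonneg hk.le]
  rw [h1, eLpNorm_const_smul, ← eLpNorm_map_measure hfm φ.continuous.aemeasurable, hφ,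
    eLpNorm_smul_measure_of_ne_top (by simp), smul_eq_mul, ← mul_assoc, hk']
  have h2 : (1 / (2 : ℝ≥0∞)).toReal = 1 / (2 : ℝ) := by simp
  rw [h2, hkk, one_mul]

theorem quasiMeasurePreserving_of_map_eq (φ : Conf d ≃ₜ Conf d) (c : ℝ≥0∞)
    (hφ : (volume : Measure (Conf d)).map φ = c • volume) :
    Measure.QuasiMeasurePreserving φ (volume : Measure (Conf d)) volume :=
  ⟨φ.continuous.measurable, by
    rw [hφ]; exact Measure.smul_absolutelyContinuous⟩

theorem memLp_weightedComp (φ : Conf d ≃ₜ Conf d) (w : Conf d → ℂ) (hw : Continuous w)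
    (k : ℝ) (hk : 0 < k) (hwk : ∀ x, ‖w x‖ = k)
    (hφ : (volume : Measure (Conf d)).map φ = ENNReal.ofReal ((k ^ 2)⁻¹) • volume)
    (f : Conf d → ℂ) (hf : MemLp f 2 (volume : Measure (Conf d))) :
    MemLp (fun x => w x * f (φ x)) 2 (volume : Measure (Conf d)) := by
  refine ⟨hw.aestronglyMeasurable.mul ?_, ?_⟩
  · exact hf.1.comp_quasiMeasurePreserving (quasiMeasurePreserving_of_map_eq φ _ hφ)
  · rw [eLpNorm_weightedComp φ w k hk hwk hφ f hf.1]
    exact hf.2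

/-- The isometry `f ↦ w · (f ∘ φ)` of `L²(ℝᵈ)`, for a weight of constant modulus `k` and a
homeomorphism `φ` that scales the volume accordingly. -/
def weightedCompIsometry (φ : Conf d ≃ₜ Conf d) (w : Conf d → ℂ) (hw : Continuous w)
    (k : ℝ) (hk : 0 < k) (hwk : ∀ x, ‖w x‖ = k)
    (hφ : (volume : Measure (Conf d)).map φ = ENNReal.ofReal ((k ^ 2)⁻¹) • volume) :
    L2 d →ₗᵢ[ℂ] L2 d where
  toFun f := (memLp_weightedComp φ w hw k hk hwk hφ f (Lp.memLp f)).toLp _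
  map_add' f g := by
    rw [← MemLp.toLp_add]
    apply MemLp.toLp_congr
    filter_upwards [(quasiMeasurePreserving_of_map_eq φ _ hφ).ae (Lp.coeFn_add f g)] with x hx
    change w x * (f + g : L2 d) (φ x) = w x * f (φ x) + w x * g (φ x)
    rw [hx, Pi.add_apply, mul_add]
  map_smul' c f := by
    rw [RingHom.id_apply, ← MemLp.toLp_const_smul]
    apply MemLp.toLp_congr
    filter_upwards [(quasiMeasurePreserving_of_map_eq φ _ hφ).ae (Lp.coeFn_smul c f)] with x hx
    simp only [hx, Pi.smul_apply, smul_eq_mul]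
    ring
  norm_map' f := by
    simp only [LinearMap.coe_mk, AddHom.coe_mk, Lp.norm_toLp]
    rw [eLpNorm_weightedComp φ w k hk hwk hφ f (Lp.aestronglyMeasurable f), Lp.norm_def]

theorem weightedCompIsometry_surjective (φ : Conf d ≃ₜ Conf d) (w : Conf d → ℂ)
    (hw : Continuous w) (k : ℝ) (hk : 0 < k) (hwk : ∀ x, ‖w x‖ = k)
    (hφ : (volume : Measure (Conf d)).map φ = ENNReal.ofReal ((k ^ 2)⁻¹) • volume) :
    Function.Surjective (weightedCompIsometry φ w hw k hk hwk hφ) := by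
  have hw0 : ∀ x, w x ≠ 0 := fun x h => by
    have := hwk x
    rw [h, norm_zero] at this
    exact hk.ne this
  have hφ' : (volume : Measure (Conf d)).map φ.symm
      = ENNReal.ofReal (((k⁻¹) ^ 2)⁻¹) • volume := by
    have h2 : ((volume : Measure (Conf d)).map φ).map φ.symm = volume := by
      rw [Measure.map_map φ.symm.continuous.measurable φ.continuous.measurable]
      simp
    rw [hφ, Measure.map_smul] at h2
    rw [← h2, smul_smul, h2, ← ENNReal.ofReal_mul (by positivity)]
    have : ((k⁻¹ ^ 2)⁻¹ * (k ^ 2)⁻¹) = 1 := by field_simp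
    rw [this]
    simp
  intro g
  have hw' : Continuous fun x => (w (φ.symm x))⁻¹ :=
    (hw.comp φ.symm.continuous).inv₀ fun x => hw0 _
  have hm := memLp_weightedComp φ.symm (fun x => (w (φ.symm x))⁻¹) hw' k⁻¹ (by positivity)
    (fun x => by simp [hwk]) hφ' g (Lp.memLp g)
  refine ⟨hm.toLp _, ?_⟩
  apply Lp.ext
  refine (MemLp.coeFn_toLp (memLp_weightedComp φ w hw k hk hwk hφ _ (Lp.memLp _))).trans ?_
  filter_upwards [(quasiMeasurePreserving_of_map_eq φ _ hφ).ae hm.coeFn_toLp] with x hx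
  rw [hx]
  simp [hw0]

/-- The unitary operator `f ↦ w · (f ∘ φ)` of `L²(ℝᵈ)`. -/
def weightedComp (φ : Conf d ≃ₜ Conf d) (w : Conf d → ℂ) (hw : Continuous w)
    (k : ℝ) (hk : 0 < k) (hwk : ∀ x, ‖w x‖ = k)
    (hφ : (volume : Measure (Conf d)).map φ = ENNReal.ofReal ((k ^ 2)⁻¹) • volume) : U d :=
  LinearIsometryEquiv.ofSurjective (weightedCompIsometry φ w hw k hk hwk hφ)
    (weightedCompIsometry_surjective φ w hw k hk hwk hφ)

theorem weightedComp_coeFn (φ : Conf d ≃ₜ Conf d) (w : Conf d → ℂ) (hw : Continuous w)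
    (k : ℝ) (hk : 0 < k) (hwk : ∀ x, ‖w x‖ = k)
    (hφ : (volume : Measure (Conf d)).map φ = ENNReal.ofReal ((k ^ 2)⁻¹) • volume) (f : L2 d) :
    weightedComp φ w hw k hk hwk hφ f =ᵐ[volume] fun x => w x * f (φ x) :=
  MemLp.coeFn_toLp (memLp_weightedComp φ w hw k hk hwk hφ f (Lp.memLp f))

end WeightedComposition

/-- The Heisenberg-Weyl operator `(T_z f)(x) = exp((i/ħ) p · (x - q/2)) f(x - q)`, `z = (q, p)`. -/
def heisenbergWeyl {d : ℕ} (ħ : ℝ) (z : Phase d) : U d :=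
  weightedComp (Homeomorph.subRight (WithLp.toLp 2 fun j => z (Sum.inl j)))
    (fun x => Complex.exp (Complex.I / ħ *
      ((∑ j, z (Sum.inr j) * (x j - z (Sum.inl j) / 2) : ℝ) : ℂ)))
    (by fun_prop) 1 one_pos
    (fun x => by
      rw [div_mul_eq_mul_div, mul_div_assoc, ← Complex.ofReal_div, mul_comm]
      exact Complex.norm_exp_ofReal_mul_I _)
    (by simpa using (measurePreserving_sub_right (volume : Measure (Conf d)) _).map_eq)

theorem heisenbergWeyl_coeFn {d : ℕ} (ħ : ℝ) (z : Phase d) (f : L2 d) :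
    heisenbergWeyl ħ z f =ᵐ[volume] fun x => Complex.exp (Complex.I / ħ *
      ((∑ j, z (Sum.inr j) * (x j - z (Sum.inl j) / 2) : ℝ) : ℂ)) *
        f (x - WithLp.toLp 2 fun j => z (Sum.inl j)) :=
  weightedComp_coeFn _ _ _ _ _ _ _ f

/-- The operator `(V_R f)(x) = exp((i/2ħ) xᵀ R x) f(x)`. -/
def opV {d : ℕ} (ħ : ℝ) (R : Matrix (Fin d) (Fin d) ℝ) : U d :=
  weightedComp (Homeomorph.refl _)
    (fun x => Complex.exp (Complex.I / (2 * ħ) * ((x.ofLp ⬝ᵥ R *ᵥ x.ofLp : ℝ) : ℂ)))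
    (by fun_prop) 1 one_pos
    (fun x => by
      have : Complex.I / (2 * ħ) * ((x.ofLp ⬝ᵥ R *ᵥ x.ofLp : ℝ) : ℂ)
          = ((x.ofLp ⬝ᵥ R *ᵥ x.ofLp / (2 * ħ) : ℝ) : ℂ) * Complex.I := by
        push_cast; ring
      rw [this]
      exact Complex.norm_exp_ofReal_mul_I _)
    (by simp)

theorem opV_coeFn {d : ℕ} (ħ : ℝ) (R : Matrix (Fin d) (Fin d) ℝ) (f : L2 d) :
    opV ħ R f =ᵐ[volume] fun x =>
      Complex.exp (Complex.I / (2 * ħ) * ((x.ofLp ⬝ᵥ R *ᵥ x.ofLp : ℝ) : ℂ)) * f x :=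
  weightedComp_coeFn _ _ _ _ _ _ _ f

/-- The homeomorphism `x ↦ L x` of `ℝᵈ`. -/
def glHomeo {d : ℕ} (L : GL (Fin d) ℝ) : Conf d ≃ₜ Conf d where
  toFun x := Matrix.toEuclideanLin L.1 x
  invFun x := Matrix.toEuclideanLin (L⁻¹).1 x
  left_inv x := by
    simp [Matrix.toLpLin_apply]
  right_inv x := by
    simp [Matrix.toLpLin_apply]
  continuous_toFun := LinearMap.continuous_of_finiteDimensional _
  continuous_invFun := LinearMap.continuous_of_finiteDimensional _

/-- The operator `(M_L^m f)(x) = iᵐ |det L|^{1/2} f(L x)`. -/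
def opM {d : ℕ} (L : GL (Fin d) ℝ) (m : ℤ) : U d :=
  weightedComp (glHomeo L) (fun _ => Complex.I ^ m * (√|L.1.det| : ℝ)) continuous_const
    (√|L.1.det|)
    (Real.sqrt_pos.2 (abs_pos.2 (Matrix.GeneralLinearGroup.det_ne_zero L)))
    (fun x => by simp)
    (by
      have hdet : LinearMap.det (Matrix.toEuclideanLin L.1) = L.1.det := by
        have e : Matrix.toEuclideanLin L.1 = ((WithLp.linearEquiv 2 ℝ (Fin d → ℝ)).symm :
            (Fin d → ℝ) →ₗ[ℝ] Conf d) ∘ₗ Matrix.toLin' L.1 ∘ₗ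
            ((WithLp.linearEquiv 2 ℝ (Fin d → ℝ)).symm.symm : Conf d →ₗ[ℝ] (Fin d → ℝ)) := rfl
        rw [e, LinearMap.det_conj, LinearMap.det_toLin']
      have h := Measure.map_linearMap_addHaar_eq_smul_addHaar (volume : Measure (Conf d))
        (f := Matrix.toEuclideanLin L.1)
        (by rw [hdet]; exact Matrix.GeneralLinearGroup.det_ne_zero L)
      rw [hdet] at h
      rw [Real.sq_sqrt (abs_nonneg _), ← abs_inv]
      exact h)

theorem opM_coeFn {d : ℕ} (L : GL (Fin d) ℝ) (m : ℤ) (f : L2 d) :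
    opM L m f =ᵐ[volume] fun x =>
      Complex.I ^ m * (√|L.1.det| : ℝ) * f (Matrix.toEuclideanLin L.1 x) :=
  weightedComp_coeFn _ _ _ _ _ _ _ f

theorem norm_opJ_weight {d : ℕ} {ħ : ℝ} (hħ : 0 < ħ) :
    ‖((2 * Real.pi * ħ * Complex.I : ℂ) ^ ((d : ℂ) / 2))⁻¹‖
      = ((2 * Real.pi * ħ) ^ ((d : ℝ) / 2))⁻¹ := by
  have hpos : 0 < 2 * Real.pi * ħ := by positivity
  have h0 : (2 * Real.pi * ħ * Complex.I : ℂ) ≠ 0 := by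
    simp [hħ.ne', Real.pi_ne_zero]
  have him : ((d : ℂ) / 2).im = 0 := by simp
  have hre : ((d : ℂ) / 2).re = (d : ℝ) / 2 := by simp
  rw [norm_inv, Complex.norm_cpow_of_ne_zero h0, him, hre]
  simp [abs_of_pos hħ, abs_of_pos Real.pi_pos]

/-- The rescaling `(D f)(x) = (2πħi)^{-d/2} f(x / 2πħ)` of `L²(ℝᵈ)` (principal branch). -/
def rescale {d : ℕ} {ħ : ℝ} (hħ : 0 < ħ) : U d :=
  weightedComp (Homeomorph.smulOfNeZero (2 * Real.pi * ħ)⁻¹ (by positivity))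
    (fun _ => ((2 * Real.pi * ħ * Complex.I : ℂ) ^ ((d : ℂ) / 2))⁻¹) continuous_const
    ((2 * Real.pi * ħ) ^ ((d : ℝ) / 2))⁻¹ (by positivity)
    (fun _ => norm_opJ_weight hħ)
    (by
      have hpos : 0 < 2 * Real.pi * ħ := by positivity
      have h := Measure.map_addHaar_smul (volume : Measure (Conf d))
        (r := (2 * Real.pi * ħ)⁻¹) (by positivity)
      have e : ((((2 * Real.pi * ħ) ^ ((d : ℝ) / 2))⁻¹ ^ 2)⁻¹)
          = |(((2 * Real.pi * ħ)⁻¹) ^ Module.finrank ℝ (Conf d))⁻¹| := by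
        rw [abs_of_pos (by positivity), finrank_euclideanSpace_fin, inv_pow, inv_pow, inv_inv,
          inv_inv, ← Real.rpow_natCast, ← Real.rpow_mul hpos.le, ← Real.rpow_natCast]
        congr 1
        push_cast
        ring
      rw [e]
      exact h)

theorem rescale_coeFn {d : ℕ} {ħ : ℝ} (hħ : 0 < ħ) (f : L2 d) :
    rescale hħ f =ᵐ[volume] fun x =>
      ((2 * Real.pi * ħ * Complex.I : ℂ) ^ ((d : ℂ) / 2))⁻¹ * f ((2 * Real.pi * ħ)⁻¹ • x) :=
  weightedComp_coeFn _ _ _ _ _ _ _ f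

/-- The operator `Ĵ`: the unitary extension to `L²(ℝᵈ)` of
`(Ĵ ψ)(x) = (2πħi)^{-d/2} ∫ exp(-(i/ħ) x · y) ψ(y) dy` (principal branch), obtained by rescaling
the Fourier-Plancherel transform, whose kernel is `exp(-2πi x · y)`. -/
def opJ {d : ℕ} {ħ : ℝ} (hħ : 0 < ħ) : U d :=
  (Lp.fourierTransformₗᵢ (Conf d) ℂ).trans <|
    rescale hħ

theorem opJ_schwartz {d : ℕ} {ħ : ℝ} (hħ : 0 < ħ) (ψ : 𝓢(Conf d, ℂ)) :
    opJ hħ (ψ.toLp 2 volume) =ᵐ[volume] fun x =>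
      ((2 * Real.pi * ħ * Complex.I : ℂ) ^ ((d : ℂ) / 2))⁻¹ *
        ∫ y, Complex.exp (-(Complex.I / ħ) * ((∑ j, x j * y j : ℝ) : ℂ)) * ψ y := by
  have hpos : 0 < 2 * Real.pi * ħ := by positivity
  have hr : (2 * Real.pi * ħ)⁻¹ ≠ 0 := by positivity
  have hq : Measure.QuasiMeasurePreserving
      (Homeomorph.smulOfNeZero (α := Conf d) (2 * Real.pi * ħ)⁻¹ hr) volume volume :=
    quasiMeasurePreserving_of_map_eq _ _ (Measure.map_addHaar_smul volume hr)
  have h1 : (Lp.fourierTransformₗᵢ (Conf d) ℂ) (ψ.toLp 2 volume) = (𝓕 ψ).toLp 2 volume :=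
    SchwartzMap.toLp_fourier_eq ψ
  have e : opJ hħ (ψ.toLp 2 volume) = rescale hħ ((𝓕 ψ).toLp 2 volume) :=
    congrArg (rescale hħ) h1
  rw [e]
  refine (rescale_coeFn hħ _).trans ?_
  filter_upwards [hq.ae ((𝓕 ψ).coeFn_toLp 2 volume)] with x hx
  change _ * ((𝓕 ψ).toLp 2 volume : L2 d) (Homeomorph.smulOfNeZero (2 * Real.pi * ħ)⁻¹ hr x) = _
  rw [hx, SchwartzMap.fourier_coe, Real.fourier_eq']
  congr 1
  apply integral_congr_ae
  refine Filter.Eventually.of_forall fun y => ?_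
  simp only [smul_eq_mul]
  congr 2
  have : inner ℝ y (Homeomorph.smulOfNeZero (2 * Real.pi * ħ)⁻¹ hr x)
      = (2 * Real.pi * ħ)⁻¹ * ∑ j, x j * y j := by
    simp [inner_smul_right, PiLp.inner_apply]
  rw [this]
  push_cast
  field_simp

/-- The matrix `J = [0, I; -I, 0]`. -/
def matJ (d : ℕ) (R : Type*) [CommRing R] : Matrix (Fin d ⊕ Fin d) (Fin d ⊕ Fin d) R :=
  Matrix.fromBlocks 0 1 (-1) 0

/-- `J` as an element of `Sp(2d, ℝ)`. -/
def spJ (d : ℕ) : Sp d :=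
  ⟨matJ d ℝ, by simp [matJ, SymplecticGroup.fromBlocks_mem_iff]⟩

/-- `V_R = [I, 0; R, I]` for a symmetric matrix `R`. -/
def spV {d : ℕ} (R : Matrix (Fin d) (Fin d) ℝ) (hR : R.IsSymm) : Sp d :=
  ⟨Matrix.fromBlocks 1 0 R 1, by simp [SymplecticGroup.fromBlocks_mem_iff, hR.eq]⟩

/-- `M_L = [L⁻¹, 0; 0, Lᵀ]` for an invertible matrix `L`. -/
def spM {d : ℕ} (L : GL (Fin d) ℝ) : Sp d :=
  ⟨Matrix.fromBlocks (L⁻¹).1 0 0 L.1ᵀ, by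
    simp [SymplecticGroup.fromBlocks_mem_iff, ← Matrix.transpose_mul]⟩

/-- The generators of the metaplectic group, each paired with its symplectic matrix.
The index `m` of `M_L^m` satisfies `mπ ≡ arg (det L) (mod 2π)`. -/
inductive IsGenerator {d : ℕ} {ħ : ℝ} (hħ : 0 < ħ) : U d × Sp d → Prop
  | genJ : IsGenerator hħ (opJ hħ, spJ d)
  | genV (R : Matrix (Fin d) (Fin d) ℝ) (hR : R.IsSymm) : IsGenerator hħ (opV ħ R, spV R hR)
  | genM (L : GL (Fin d) ℝ) (m : ℤ)
      (hm : ∃ k : ℤ, (m : ℝ) * Real.pi = Complex.arg ((L.1.det : ℝ) : ℂ) + 2 * Real.pi * k) :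
      IsGenerator hħ (opM L m, spM L)

/-- The metaplectic group `Mp(2d, ℝ)`: the group of unitary operators generated by `Ĵ`, the `V_R`
and the `M_L^m`. -/
def Mp (d : ℕ) {ħ : ℝ} (hħ : 0 < ħ) : Subgroup (U d) :=
  Subgroup.closure (Prod.fst '' {g : U d × Sp d | IsGenerator hħ g})

/-- The graph of the projection `π_Mp : Mp(2d, ℝ) → Sp(2d, ℝ)`, the homomorphism which sends the
generators `Ĵ`, `V_R`, `M_L^m` to `J`, `V_R`, `M_L`. -/
def projGraph (d : ℕ) {ħ : ℝ} (hħ : 0 < ħ) : Subgroup (U d × Sp d) :=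
  Subgroup.closure {g : U d × Sp d | IsGenerator hħ g}

/-- `Ŝ` is a metaplectic operator over the symplectic matrix `S`, that is, `Ŝ ∈ Mp(2d, ℝ)` and
`π_Mp(Ŝ) = S`. -/
def IsOver {d : ℕ} {ħ : ℝ} (hħ : 0 < ħ) (Shat : U d) (S : Sp d) : Prop :=
  (Shat, S) ∈ projGraph d hħ

theorem mem_Mp_iff {d : ℕ} {ħ : ℝ} (hħ : 0 < ħ) (Shat : U d) :
    Shat ∈ Mp d hħ ↔ ∃ S : Sp d, IsOver hħ Shat S := by
  have h : Mp d hħ = (projGraph d hħ).map (MonoidHom.fst (U d) (Sp d)) := by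
    rw [projGraph, MonoidHom.map_closure]; rfl
  rw [h]
  simp [Subgroup.mem_map, IsOver]

theorem IsOver.mul {d : ℕ} {ħ : ℝ} {hħ : 0 < ħ} {A B : U d} {S T : Sp d}
    (hA : IsOver hħ A S) (hB : IsOver hħ B T) : IsOver hħ (A * B) (S * T) :=
  (projGraph d hħ).mul_mem hA hB

theorem IsOver.inv {d : ℕ} {ħ : ℝ} {hħ : 0 < ħ} {A : U d} {S : Sp d}
    (hA : IsOver hħ A S) : IsOver hħ A⁻¹ S⁻¹ :=
  (projGraph d hħ).inv_mem hA

section Surjectivity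

variable {d : ℕ} {ħ : ℝ}

theorem isOver_J (hħ : 0 < ħ) : IsOver hħ (opJ hħ) (spJ d) :=
  Subgroup.subset_closure IsGenerator.genJ

theorem isOver_V (hħ : 0 < ħ) (R : Matrix (Fin d) (Fin d) ℝ) (hR : R.IsSymm) :
    IsOver hħ (opV ħ R) (spV R hR) :=
  Subgroup.subset_closure (IsGenerator.genV R hR)

theorem exists_isOver_M (hħ : 0 < ħ) (L : GL (Fin d) ℝ) : ∃ A, IsOver hħ A (spM L) := by
  rcases lt_or_gt_of_ne (Matrix.GeneralLinearGroup.det_ne_zero L) with h | h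
  · exact ⟨opM L 1, Subgroup.subset_closure (IsGenerator.genM L 1
      ⟨0, by rw [Complex.arg_ofReal_of_neg h]; simp⟩)⟩
  · exact ⟨opM L 0, Subgroup.subset_closure (IsGenerator.genM L 0
      ⟨0, by rw [Complex.arg_ofReal_of_nonneg h.le]; simp⟩)⟩

theorem exists_isOver_of_free (hħ : 0 < ħ) (A B C D : Matrix (Fin d) (Fin d) ℝ)
    (hS : Matrix.fromBlocks A B C D ∈ Matrix.symplecticGroup (Fin d) ℝ) (hB : B.det ≠ 0) :
    ∃ F, IsOver hħ F ⟨Matrix.fromBlocks A B C D, hS⟩ := by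
  have hu : IsUnit B.det := isUnit_iff_ne_zero.2 hB
  obtain ⟨h1, h2, h3⟩ := SymplecticGroup.fromBlocks_mem_iff.1 hS
  have hT := SymplecticGroup.transpose_mem hS
  rw [Matrix.fromBlocks_transpose, SymplecticGroup.fromBlocks_mem_iff] at hT
  simp only [Matrix.transpose_transpose] at hT
  obtain ⟨k1, k2, k3⟩ := hT
  have hBB : B * B⁻¹ = 1 := Matrix.mul_nonsing_inv _ hu
  have hBB' : B⁻¹ * B = 1 := Matrix.nonsing_inv_mul _ hu
  have hBt : Bᵀ * B⁻¹ᵀ = 1 := by rw [← Matrix.transpose_mul, hBB', Matrix.transpose_one]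
  have hBt' : B⁻¹ᵀ * Bᵀ = 1 := by rw [← Matrix.transpose_mul, hBB, Matrix.transpose_one]
  have hP : (D * B⁻¹).IsSymm := by
    rw [Matrix.IsSymm, Matrix.transpose_mul]
    calc B⁻¹ᵀ * Dᵀ = B⁻¹ᵀ * (Dᵀ * B) * B⁻¹ := by
          rw [Matrix.mul_assoc, Matrix.mul_assoc, hBB, Matrix.mul_one]
      _ = (B⁻¹ᵀ * Bᵀ) * D * B⁻¹ := by rw [← h2]; simp only [Matrix.mul_assoc]
      _ = D * B⁻¹ := by rw [hBt', Matrix.one_mul]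
  have hQ : (B⁻¹ * A).IsSymm := by
    rw [Matrix.IsSymm, Matrix.transpose_mul]
    calc Aᵀ * B⁻¹ᵀ = B⁻¹ * (B * Aᵀ) * B⁻¹ᵀ := by
          rw [← Matrix.mul_assoc B⁻¹, hBB', Matrix.one_mul]
      _ = B⁻¹ * A * (Bᵀ * B⁻¹ᵀ) := by rw [← k1]; simp only [Matrix.mul_assoc]
      _ = B⁻¹ * A := by rw [hBt, Matrix.mul_one]
  let L : GL (Fin d) ℝ := ⟨B⁻¹, B, hBB', hBB⟩
  obtain ⟨M, hM⟩ := exists_isOver_M hħ L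
  have key := ((isOver_V hħ _ hP).mul hM).mul ((isOver_J hħ).mul (isOver_V hħ _ hQ))
  have hL : ((L⁻¹ : GL (Fin d) ℝ) : Matrix (Fin d) (Fin d) ℝ) = B := rfl
  have hL' : (L : Matrix (Fin d) (Fin d) ℝ) = B⁻¹ := rfl
  have hC : C = D * B⁻¹ * A - B⁻¹ᵀ := by
    have e : Bᵀ * C = Dᵀ * A - 1 := by
      have := congrArg Matrix.transpose h3
      simp only [Matrix.transpose_sub, Matrix.transpose_mul, Matrix.transpose_transpose,
        Matrix.transpose_one] at this
      rw [← this]; abel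
    calc C = B⁻¹ᵀ * (Bᵀ * C) := by rw [← Matrix.mul_assoc, hBt', Matrix.one_mul]
      _ = (D * B⁻¹)ᵀ * A - B⁻¹ᵀ := by
        rw [e, Matrix.mul_sub, Matrix.mul_one, Matrix.transpose_mul, Matrix.mul_assoc]
      _ = D * B⁻¹ * A - B⁻¹ᵀ := by rw [hP.eq]
  have heq : spV (D * B⁻¹) hP * spM L * (spJ d * spV (B⁻¹ * A) hQ)
      = ⟨Matrix.fromBlocks A B C D, hS⟩ := by
    apply Subtype.ext
    simp only [spV, spM, spJ, matJ, Submonoid.coe_mul, Matrix.fromBlocks_multiply, hL, hL']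
    rw [Matrix.fromBlocks_inj]
    refine ⟨?_, ?_, ?_, ?_⟩
    · simp [← Matrix.mul_assoc, hBB]
    · simp
    · rw [hC]
      simp [Matrix.mul_assoc, ← Matrix.mul_assoc B, hBB, sub_eq_add_neg]
    · simp [Matrix.mul_assoc, hBB']
  rw [heq] at key
  exact ⟨_, key⟩

theorem exists_det_add_smul_ne_zero (A B C D : Matrix (Fin d) (Fin d) ℝ)
    (hS : Matrix.fromBlocks A B C D ∈ Matrix.symplecticGroup (Fin d) ℝ) :
    ∃ t : ℝ, (A + t • B).det ≠ 0 := by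
  by_contra! hcon
  have hT := SymplecticGroup.transpose_mem hS
  rw [Matrix.fromBlocks_transpose, SymplecticGroup.fromBlocks_mem_iff] at hT
  simp only [Matrix.transpose_transpose] at hT
  obtain ⟨k1, -, k3⟩ := hT
  -- the polynomial `det (A + X B)` vanishes identically, hence also at `X = i`
  set p : Polynomial ℝ := (A.map Polynomial.C + (Polynomial.X : Polynomial ℝ) •
    B.map Polynomial.C).det with hp
  have hp0 : p = 0 := by
    apply Polynomial.funext
    intro t
    have : (Polynomial.evalRingHom t) p = (A + t • B).det := by
      rw [hp, RingHom.map_det]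
      congr 1
      ext i j
      simp
      ring
    rw [Polynomial.eval_zero, ← hcon t, ← this]
    rfl
  have hI : (A.map (fun r : ℝ => (r : ℂ)) + Complex.I • B.map (fun r : ℝ => (r : ℂ))).det = 0 := by
    have : (Polynomial.eval₂RingHom (Complex.ofRealHom) Complex.I) p
        = (A.map (fun r : ℝ => (r : ℂ)) + Complex.I • B.map (fun r : ℝ => (r : ℂ))).det := by
      rw [hp, RingHom.map_det]
      congr 1
      ext i j
      simp
      ring
    rw [← this, hp0, map_zero]
  have hprod : (A.map (fun r : ℝ => (r : ℂ)) + Complex.I • B.map (fun r : ℝ => (r : ℂ))) *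
      (Aᵀ.map (fun r : ℝ => (r : ℂ)) - Complex.I • Bᵀ.map (fun r : ℝ => (r : ℂ)))
      = (A * Aᵀ + B * Bᵀ).map (fun r : ℝ => (r : ℂ)) := by
    have hm : ∀ X Y : Matrix (Fin d) (Fin d) ℝ, X.map (fun r : ℝ => (r : ℂ)) *
        Y.map (fun r : ℝ => (r : ℂ)) = (X * Y).map (fun r : ℝ => (r : ℂ)) := fun X Y =>
      (Matrix.map_mul (f := Complex.ofRealHom)).symm
    rw [Matrix.add_mul, Matrix.mul_sub, Matrix.mul_sub]
    simp only [Matrix.smul_mul, Matrix.mul_smul, hm, smul_smul, Complex.I_mul_I, k1]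
    ext i j
    simp
    ring
  have hdet : (A * Aᵀ + B * Bᵀ).det = 0 := by
    have h : ((A * Aᵀ + B * Bᵀ).map (fun r : ℝ => (r : ℂ))).det = 0 := by
      rw [← hprod, Matrix.det_mul, hI, zero_mul]
    have h' : Complex.ofRealHom (A * Aᵀ + B * Bᵀ).det = 0 := by
      rw [RingHom.map_det]; exact h
    simpa using h'
  obtain ⟨v, hv, hv0⟩ := Matrix.exists_mulVec_eq_zero_iff.2 hdet
  have hsum : (Aᵀ *ᵥ v) ⬝ᵥ (Aᵀ *ᵥ v) + (Bᵀ *ᵥ v) ⬝ᵥ (Bᵀ *ᵥ v) = 0 := by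
    have h := congrArg (fun u => v ⬝ᵥ u) hv0
    simp only [Matrix.add_mulVec, dotProduct_add, dotProduct_zero] at h
    rw [← h]
    congr 1 <;> rw [← Matrix.mulVec_mulVec, Matrix.dotProduct_mulVec v, Matrix.mulVec_transpose]
  have hA0 : 0 ≤ (Aᵀ *ᵥ v) ⬝ᵥ (Aᵀ *ᵥ v) := Finset.sum_nonneg fun i _ => mul_self_nonneg _
  have hB0 : 0 ≤ (Bᵀ *ᵥ v) ⬝ᵥ (Bᵀ *ᵥ v) := Finset.sum_nonneg fun i _ => mul_self_nonneg _
  have hA : Aᵀ *ᵥ v = 0 := dotProduct_self_eq_zero.1 (by linarith)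
  have hB : Bᵀ *ᵥ v = 0 := dotProduct_self_eq_zero.1 (by linarith)
  have k3' : D * Aᵀ - C * Bᵀ = 1 := by
    have := congrArg Matrix.transpose k3
    simpa [Matrix.transpose_sub, Matrix.transpose_mul] using this
  apply hv
  rw [← Matrix.one_mulVec v, ← k3', Matrix.sub_mulVec, ← Matrix.mulVec_mulVec,
    ← Matrix.mulVec_mulVec, hA, hB]
  simp

/-- Every symplectic matrix has a metaplectic operator over it. -/
theorem exists_isOver (hħ : 0 < ħ) (S : Sp d) : ∃ Shat, IsOver hħ Shat S := by
  obtain ⟨S, hS⟩ := S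
  obtain ⟨A, B, C, D, rfl⟩ : ∃ A B C D, S = Matrix.fromBlocks A B C D :=
    ⟨_, _, _, _, (Matrix.fromBlocks_toBlocks S).symm⟩
  obtain ⟨t, ht⟩ := exists_det_add_smul_ne_zero A B C D hS
  have hR : (t • (1 : Matrix (Fin d) (Fin d) ℝ)).IsSymm := by simp [Matrix.IsSymm]
  have e : (⟨Matrix.fromBlocks A B C D, hS⟩ : Sp d) * spV _ hR * spJ d
      = ⟨Matrix.fromBlocks (-B) (A + t • B) (-D) (C + t • D), by
          have := (⟨Matrix.fromBlocks A B C D, hS⟩ * spV _ hR * spJ d : Sp d).2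
          simpa [spV, spJ, matJ, Matrix.fromBlocks_multiply] using this⟩ := by
    apply Subtype.ext
    simp [spV, spJ, matJ, Matrix.fromBlocks_multiply]
  obtain ⟨F, hF⟩ := exists_isOver_of_free hħ (-B) (A + t • B) (-D) (C + t • D) _ ht
  rw [← e] at hF
  have := (hF.mul (isOver_J hħ).inv).mul (isOver_V hħ _ hR).inv
  rw [mul_inv_cancel_right, mul_inv_cancel_right] at this
  exact ⟨_, this⟩

end Surjectivity

/-- A metaplectic operator `Ŝ` over `S`; it is unique up to sign. -/
def lift {d : ℕ} {ħ : ℝ} (hħ : 0 < ħ) (S : Sp d) : U d := (exists_isOver hħ S).choose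

theorem isOver_lift {d : ℕ} {ħ : ℝ} (hħ : 0 < ħ) (S : Sp d) : IsOver hħ (lift hħ S) S :=
  (exists_isOver hħ S).choose_spec

/-- The position and momentum operators `ẑ = (x̂, p̂)` on the Schwartz space:
`x̂_j f(x) = x_j f(x)` and `p̂_j f = -iħ ∂f/∂x_j`. -/
def zhat {d : ℕ} (ħ : ℝ) : Fin d ⊕ Fin d → (𝓢(Conf d, ℂ) →ₗ[ℂ] 𝓢(Conf d, ℂ))
  | Sum.inl j => (smulLeftCLM ℂ (fun x : Conf d => ((x j : ℝ) : ℂ))).toLinearMap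
  | Sum.inr j => (-(Complex.I * ħ)) •
      (LineDeriv.lineDerivOpCLM ℂ 𝓢(Conf d, ℂ) (EuclideanSpace.single j (1 : ℝ))).toLinearMap

theorem zhat_inl_apply {d : ℕ} (ħ : ℝ) (j : Fin d) (f : 𝓢(Conf d, ℂ)) (x : Conf d) :
    zhat ħ (Sum.inl j) f x = x j * f x := by
  have : (fun x : Conf d => ((x j : ℝ) : ℂ)).HasTemperateGrowth :=
    (Complex.ofRealCLM ∘L (EuclideanSpace.proj j : Conf d →L[ℝ] ℝ)).hasTemperateGrowth
  simp [zhat, smulLeftCLM_apply_apply this]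

theorem zhat_inr_apply {d : ℕ} (ħ : ℝ) (j : Fin d) (f : 𝓢(Conf d, ℂ)) (x : Conf d) :
    zhat ħ (Sum.inr j) f x
      = -Complex.I * ħ * lineDeriv ℝ f x (EuclideanSpace.single j (1 : ℝ)) := by
  rw [← SchwartzMap.lineDerivOp_apply]
  simp [zhat]

/-- The `2d` operators `ρ(X; ẑ) = Xᵀ J ẑ`, for a complex matrix `X` and operators `ẑ`. -/
def rho {d : ℕ} (X : Matrix (Fin d ⊕ Fin d) (Fin d ⊕ Fin d) ℂ)
    (z : Fin d ⊕ Fin d → (𝓢(Conf d, ℂ) →ₗ[ℂ] 𝓢(Conf d, ℂ))) (j : Fin d ⊕ Fin d) :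
    𝓢(Conf d, ℂ) →ₗ[ℂ] 𝓢(Conf d, ℂ) :=
  ∑ k, (Xᵀ * matJ d ℂ) j k • z k

/-- The matrix `W_ħ = (2ħ)^{-1/2} [i I, -i I; -I, -I]`. -/
def matW (d : ℕ) (ħ : ℝ) : Matrix (Fin d ⊕ Fin d) (Fin d ⊕ Fin d) ℂ :=
  ((√(2 * ħ) : ℝ) : ℂ)⁻¹ •
    Matrix.fromBlocks (Complex.I • 1) (-(Complex.I • 1)) (-1) (-1)

/-- The lowering operators `ρ♭(W_ħ; ẑ)` are `(2ħ)^{-1/2} (x̂ + i p̂)`. -/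
theorem rho_matW_inl {d : ℕ} (ħ : ℝ) (j : Fin d) :
    rho (matW d ħ) (zhat ħ) (Sum.inl j) = ((√(2 * ħ) : ℝ) : ℂ)⁻¹ •
      (zhat ħ (Sum.inl j) + Complex.I • zhat ħ (Sum.inr j)) := by
  simp [rho, matW, matJ, Matrix.fromBlocks_transpose, Matrix.fromBlocks_multiply,
    Matrix.one_apply, smul_smul, smul_add]

/-- The raising operators `ρ♯(W_ħ; ẑ)` are `(2ħ)^{-1/2} (x̂ - i p̂)`. -/
theorem rho_matW_inr {d : ℕ} (ħ : ℝ) (j : Fin d) :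
    rho (matW d ħ) (zhat ħ) (Sum.inr j) = ((√(2 * ħ) : ℝ) : ℂ)⁻¹ •
      (zhat ħ (Sum.inl j) - Complex.I • zhat ħ (Sum.inr j)) := by
  simp [rho, matW, matJ, Matrix.fromBlocks_transpose, Matrix.fromBlocks_multiply,
    Matrix.one_apply, smul_smul, sub_eq_add_neg]

/-- The embedding of the Schwartz space into `L²(ℝᵈ)`. -/
def schwartzToL2 (d : ℕ) : 𝓢(Conf d, ℂ) →ₗ[ℂ] L2 d :=
  (toLpCLM ℂ ℂ 2 (volume : Measure (Conf d))).toLinearMap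

theorem schwartzToL2_injective (d : ℕ) : Function.Injective (schwartzToL2 d) :=
  SchwartzMap.injective_toLp 2 (volume : Measure (Conf d))

/-- An operator on the Schwartz space as an unbounded operator on `L²(ℝᵈ)` whose domain is the
Schwartz space. -/
def schwartzOp {d : ℕ} (B : 𝓢(Conf d, ℂ) →ₗ[ℂ] 𝓢(Conf d, ℂ)) : L2 d →ₗ.[ℂ] L2 d where
  domain := LinearMap.range (schwartzToL2 d)
  toFun := schwartzToL2 d ∘ₗ B ∘ₗ
    ((LinearEquiv.ofInjective (schwartzToL2 d) (schwartzToL2_injective d)).symm :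
      LinearMap.range (schwartzToL2 d) →ₗ[ℂ] 𝓢(Conf d, ℂ))

theorem schwartzOp_apply {d : ℕ} (B : 𝓢(Conf d, ℂ) →ₗ[ℂ] 𝓢(Conf d, ℂ)) (f : 𝓢(Conf d, ℂ)) :
    schwartzOp B ⟨schwartzToL2 d f, LinearMap.mem_range_self _ f⟩ = schwartzToL2 d (B f) := by
  have : (LinearEquiv.ofInjective (schwartzToL2 d) (schwartzToL2_injective d)).symm
      ⟨schwartzToL2 d f, LinearMap.mem_range_self _ f⟩ = f := by
    rw [LinearEquiv.symm_apply_eq]; rfl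
  exact congrArg (fun g => schwartzToL2 d (B g)) this

/-- The conjugate `V A V*` of an unbounded operator `A` by a unitary operator `V`, with its natural
domain `{f | V* f ∈ D(A)}`. -/
def conj {d : ℕ} (V : U d) (A : L2 d →ₗ.[ℂ] L2 d) : L2 d →ₗ.[ℂ] L2 d where
  domain := A.domain.comap (V⁻¹ : U d).toLinearEquiv.toLinearMap
  toFun := V.toLinearEquiv.toLinearMap ∘ₗ A.toFun ∘ₗ
    ((V⁻¹ : U d).toLinearEquiv.toLinearMap.restrict fun _ hf => hf)

/-- The `2d` operators `(𝒜(S, z), 𝒜*(S, z)) = T_z Ŝ ρ(W_ħ; ẑ) Ŝ* T_z*`. -/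
def ladder {d : ℕ} {ħ : ℝ} (hħ : 0 < ħ) (S : Sp d) (z : Phase d) (j : Fin d ⊕ Fin d) :
    L2 d →ₗ.[ℂ] L2 d :=
  conj (heisenbergWeyl ħ z) (conj (lift hħ S) (schwartzOp (rho (matW d ħ) (zhat ħ) j)))

/-- The Hagedorn lowering operator `𝒜_j(S, z)`. -/
def lowering {d : ℕ} {ħ : ℝ} (hħ : 0 < ħ) (S : Sp d) (z : Phase d) (j : Fin d) :
    L2 d →ₗ.[ℂ] L2 d :=
  ladder hħ S z (Sum.inl j)

/-- The Hagedorn raising operator `𝒜*_j(S, z)`. -/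
def raising {d : ℕ} {ħ : ℝ} (hħ : 0 < ħ) (S : Sp d) (z : Phase d) (j : Fin d) :
    L2 d →ₗ.[ℂ] L2 d :=
  ladder hħ S z (Sum.inr j)

end Hagedorn

end

noncomputable section

namespace Hagedorn

variable {d : ℕ} {ħ : ℝ}

/-! Each unitary in play maps the Schwartz space onto itself and transforms the vector `ẑ` affinely:
a metaplectic operator over `S` satisfies `Ŝ* ẑ Ŝ = S ẑ`, and `T_z* ẑ T_z = ẑ + z`. Such relations
compose like affine maps, so `Ŝ₀ T_z Ŝ` and `T_{S₀z} (S₀S)^` both implement the linear part `S₀S`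
with translation `S₀z`.

Inverting `V* ẑ V = S ẑ + b` gives `V ẑ V* = S⁻¹(ẑ - b)`, in which `V` no longer occurs. Hence
conjugating a linear combination of the entries of `ẑ`, with the Schwartz space as domain, gives an
operator that depends on `V` only through `(S, b)` (`Implements.conj_schwartzOp_rho_eq`). The ladder
operators are conjugates of such combinations, so the two products yield the same operators. Neither
the uniqueness of `Ŝ` up to sign nor the commutation rule `Ŝ₀ T_z Ŝ₀* = T_{S₀z}` is needed.

It remains to check the affine law on the generators: the product rule for `V_R`, the chain rule for
`M_L^m`, the exchange of multiplication and differentiation under the Fourier transform for `Ĵ`.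
Closure induction (`implements_of_isOver`) then reaches the whole metaplectic group. -/

/-- The unitary `V` preserves the Schwartz space and transforms `ẑ` affinely:
`V* ẑ V = S ẑ + b` on Schwartz functions. -/
def Implements (ħ : ℝ) (V : U d) (S : Matrix (Fin d ⊕ Fin d) (Fin d ⊕ Fin d) ℝ)
    (b : Phase d) : Prop :=
  ∃ Φ : 𝓢(Conf d, ℂ) ≃ₗ[ℂ] 𝓢(Conf d, ℂ),
    (∀ f, V (schwartzToL2 d f) = schwartzToL2 d (Φ f)) ∧
    ∀ k f, Φ (∑ l, (S k l : ℂ) • zhat ħ l f + (b k : ℂ) • f) = zhat ħ k (Φ f)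

/-! ### Calculus of affine actions on `ẑ` -/

/-- Affine substitution: `W* (S ẑ + b) W = S (T ẑ + c) + b`. -/
theorem Implements.mul {V W : U d} {S T : Matrix (Fin d ⊕ Fin d) (Fin d ⊕ Fin d) ℝ}
    {b c : Phase d} (hV : Implements ħ V S b) (hW : Implements ħ W T c) :
    Implements ħ (V * W) (S * T) (S *ᵥ c + b) := by
  obtain ⟨Φ, hΦ, hΦz⟩ := hV
  obtain ⟨Ψ, hΨ, hΨz⟩ := hW
  refine ⟨Ψ.trans Φ, fun f => ?_, fun k f => ?_⟩
  · change V (W (schwartzToL2 d f)) = _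
    rw [hΨ, hΦ]; rfl
  · rw [LinearEquiv.trans_apply, LinearEquiv.trans_apply, ← hΦz]
    congr 1
    simp only [← hΨz, ← map_smul Ψ, ← map_sum Ψ, ← map_add Ψ]
    congr 1
    simp only [smul_add, Finset.smul_sum, smul_smul, Finset.sum_add_distrib, Matrix.mul_apply,
      Pi.add_apply, Matrix.mulVec, dotProduct, Complex.ofReal_add, Complex.ofReal_sum,
      Complex.ofReal_mul, add_smul, Finset.sum_smul]
    rw [Finset.sum_comm, add_assoc]

theorem sum_ofReal_mul_of_mul_eq_one {ι : Type*} [Fintype ι] [DecidableEq ι] {S T : Matrix ι ι ℝ}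
    (hTS : T * S = 1) (k m : ι) :
    ∑ l, (T k l : ℂ) * (S l m : ℂ) = if k = m then 1 else 0 := by
  have := congrArg (fun A => ((A k m : ℝ) : ℂ)) hTS
  simpa [Matrix.mul_apply, Matrix.one_apply, apply_ite] using this

/-- The case without translation suffices, since inverses are needed only inside the metaplectic
group. -/
theorem Implements.inv {V : U d} {S T : Matrix (Fin d ⊕ Fin d) (Fin d ⊕ Fin d) ℝ}
    (hTS : T * S = 1) (hV : Implements ħ V S 0) : Implements ħ V⁻¹ T 0 := by
  obtain ⟨Φ, hΦ, hΦz⟩ := hV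
  refine ⟨Φ.symm, fun f => ?_, fun k f => ?_⟩
  · change V.symm _ = _
    rw [LinearIsometryEquiv.symm_apply_eq, hΦ, LinearEquiv.apply_symm_apply]
  · obtain ⟨g, rfl⟩ := Φ.surjective f
    rw [LinearEquiv.symm_apply_eq, LinearEquiv.symm_apply_apply]
    simp only [← hΦz, ← map_smul Φ, ← map_sum Φ, ← map_add Φ]
    congr 1
    simp only [Pi.zero_apply, Complex.ofReal_zero, zero_smul, add_zero, Finset.smul_sum, smul_smul]
    rw [Finset.sum_comm]
    simp only [← Finset.sum_smul, sum_ofReal_mul_of_mul_eq_one hTS, ite_smul, one_smul, zero_smul,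
      Finset.sum_ite_eq, Finset.mem_univ, if_true]

theorem implements_one : Implements ħ (1 : U d) 1 0 :=
  ⟨LinearEquiv.refl ℂ _, fun _ => rfl, fun k f => by simp [Matrix.one_apply]⟩

/-! ### Conjugation of operators with Schwartz domain -/

/-- Because `Φ` is a bijection, `V* u` is a Schwartz function exactly when `u` is. The natural
domain of the conjugate is therefore again the Schwartz space, and equalities of unbounded operators
reduce to identities on Schwartz functions. -/
theorem conj_schwartzOp {V : U d} {Φ : 𝓢(Conf d, ℂ) ≃ₗ[ℂ] 𝓢(Conf d, ℂ)}
    (hΦ : ∀ f, V (schwartzToL2 d f) = schwartzToL2 d (Φ f))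
    (B : 𝓢(Conf d, ℂ) →ₗ[ℂ] 𝓢(Conf d, ℂ)) :
    conj V (schwartzOp B) = schwartzOp (Φ.toLinearMap ∘ₗ B ∘ₗ Φ.symm.toLinearMap) := by
  have hinv : ∀ f, (V⁻¹ : U d) (schwartzToL2 d f) = schwartzToL2 d (Φ.symm f) := fun f => by
    change V.symm _ = _
    rw [LinearIsometryEquiv.symm_apply_eq, hΦ, LinearEquiv.apply_symm_apply]
  have hdom : (conj V (schwartzOp B)).domain = LinearMap.range (schwartzToL2 d) := by
    ext u
    change (V⁻¹ : U d) u ∈ LinearMap.range (schwartzToL2 d) ↔ _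
    constructor
    · rintro ⟨f, hf⟩
      refine ⟨Φ f, ?_⟩
      rw [← hΦ, hf]
      exact V.apply_symm_apply u
    · rintro ⟨f, rfl⟩
      exact ⟨Φ.symm f, (hinv f).symm⟩
  refine LinearPMap.ext hdom fun u hu hu' => ?_
  obtain ⟨f, rfl⟩ := hu'
  refine Eq.trans ?_ (schwartzOp_apply _ f).symm
  change V ((schwartzOp B).toFun ⟨(V⁻¹ : U d) (schwartzToL2 d f), hu⟩) = _
  have e : (⟨(V⁻¹ : U d) (schwartzToL2 d f), hu⟩ : (schwartzOp B).domain)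
      = ⟨schwartzToL2 d (Φ.symm f), LinearMap.mem_range_self _ _⟩ := Subtype.ext (hinv f)
  rw [e]
  refine (congrArg V (schwartzOp_apply B (Φ.symm f))).trans ?_
  rw [hΦ]; rfl

/-- This is the relation `V* ẑ V = S ẑ + b` solved for `V ẑ V* = T (ẑ - b)`; the point is that the
right-hand side does not mention `V`. -/
theorem Implements.conj_schwartzOp_sum {V : U d}
    {S T : Matrix (Fin d ⊕ Fin d) (Fin d ⊕ Fin d) ℝ} {b : Phase d} (hTS : T * S = 1)
    (hV : Implements ħ V S b) (c : Fin d ⊕ Fin d → ℂ) :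
    conj V (schwartzOp (∑ k, c k • zhat ħ k)) = schwartzOp (∑ k, c k • ∑ l, (T k l : ℂ) •
      (zhat ħ l - (b l : ℂ) • LinearMap.id)) := by
  obtain ⟨Φ, hΦ, hΦz⟩ := hV
  rw [conj_schwartzOp hΦ]
  congr 1
  apply LinearMap.ext
  intro f
  obtain ⟨g, rfl⟩ := Φ.surjective f
  have hz : ∀ k, ∑ l, (T k l : ℂ) • (zhat ħ l (Φ g) - (b l : ℂ) • Φ g) = Φ (zhat ħ k g) := by
    intro k
    -- On `Φ g` the operator `ẑ - b` acts as `Φ (S ẑ g)`: the translation cancels, and `T * S = 1`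
    -- then leaves a single term.
    simp only [← hΦz, map_add, map_smul, add_sub_cancel_right]
    simp only [← map_smul Φ, ← map_sum Φ]
    congr 1
    simp only [Finset.smul_sum, smul_smul]
    rw [Finset.sum_comm]
    simp only [← Finset.sum_smul, sum_ofReal_mul_of_mul_eq_one hTS, ite_smul, one_smul, zero_smul,
      Finset.sum_ite_eq, Finset.mem_univ, if_true]
  simp only [LinearMap.comp_apply, LinearEquiv.coe_coe, LinearEquiv.symm_apply_apply,
    LinearMap.sum_apply, LinearMap.smul_apply, LinearMap.sub_apply, LinearMap.id_apply, hz,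
    map_sum, map_smul]

theorem Implements.conj_schwartzOp_rho_eq {V W : U d}
    {S T : Matrix (Fin d ⊕ Fin d) (Fin d ⊕ Fin d) ℝ} {b : Phase d} (hTS : T * S = 1)
    (hV : Implements ħ V S b) (hW : Implements ħ W S b)
    (X : Matrix (Fin d ⊕ Fin d) (Fin d ⊕ Fin d) ℂ) (j : Fin d ⊕ Fin d) :
    conj V (schwartzOp (rho X (zhat ħ) j)) = conj W (schwartzOp (rho X (zhat ħ) j)) :=
  (hV.conj_schwartzOp_sum hTS _).trans (hW.conj_schwartzOp_sum hTS _).symm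

/-! ### Phase multiplications and translations on Schwartz functions -/

/-- A weighted composition operator which maps Schwartz functions to Schwartz functions acts on
them pointwise. -/
theorem weightedComp_schwartzToL2 (φ : Conf d ≃ₜ Conf d) (w : Conf d → ℂ) (hw : Continuous w)
    (k : ℝ) (hk : 0 < k) (hwk : ∀ x, ‖w x‖ = k)
    (hφ : (volume : Measure (Conf d)).map φ = ENNReal.ofReal ((k ^ 2)⁻¹) • volume)
    (f g : 𝓢(Conf d, ℂ)) (h : ∀ x, g x = w x * f (φ x)) :
    weightedComp φ w hw k hk hwk hφ (schwartzToL2 d f) = schwartzToL2 d g := by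
  apply Lp.ext
  refine (weightedComp_coeFn φ w hw k hk hwk hφ _).trans ?_
  filter_upwards [(quasiMeasurePreserving_of_map_eq φ _ hφ).ae (f.coeFn_toLp 2 volume),
    g.coeFn_toLp 2 volume] with x hx hx'
  refine Eq.trans ?_ (hx'.trans (h x)).symm
  exact congrArg (w x * ·) hx

/-- The `n`-th derivative is `iⁿ exp(it)`, of modulus one, so every derivative satisfies the bound
with exponent `0` and constant `1`. -/
theorem hasTemperateGrowth_cexp_ofReal_mul_I :
    (fun t : ℝ => Complex.exp (t * Complex.I)).HasTemperateGrowth := by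
  have h : ∀ n : ℕ, iteratedDeriv n (fun t : ℝ => Complex.exp (t * Complex.I))
      = fun t : ℝ => Complex.I ^ n * Complex.exp (t * Complex.I) := by
    intro n
    induction n with
    | zero => simp
    | succ n ih =>
      rw [iteratedDeriv_succ, ih]
      funext t
      have h1 : HasDerivAt (fun t : ℝ => (t : ℂ) * Complex.I) Complex.I t := by
        simpa using (Complex.ofRealCLM.hasDerivAt (x := t)).mul_const Complex.I
      rw [(h1.cexp.const_mul (Complex.I ^ n)).deriv]
      ring
  refine ⟨(Complex.ofRealCLM.contDiff.mul contDiff_const).cexp, fun n => ⟨0, 1, fun t => ?_⟩⟩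
  rw [norm_iteratedFDeriv_eq_norm_iteratedDeriv, h]
  simp [Complex.norm_exp_ofReal_mul_I]

/-- Multiplication of Schwartz functions by `exp (i g)`, for a real function `g` of temperate
growth. -/
def phaseMul (g : Conf d → ℝ) (hg : g.HasTemperateGrowth) : 𝓢(Conf d, ℂ) ≃ₗ[ℂ] 𝓢(Conf d, ℂ) :=
  have h : ∀ g : Conf d → ℝ, g.HasTemperateGrowth →
      (fun x => Complex.exp (g x * Complex.I)).HasTemperateGrowth :=
    fun _ hg => hasTemperateGrowth_cexp_ofReal_mul_I.comp hg
  have hinv : ∀ g₁ g₂ : Conf d → ℝ, g₁.HasTemperateGrowth → g₂.HasTemperateGrowth →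
      (∀ x, Complex.exp (g₁ x * Complex.I) * Complex.exp (g₂ x * Complex.I) = 1) →
      (smulLeftCLM ℂ fun x => Complex.exp (g₁ x * Complex.I)).toLinearMap ∘ₗ
        (smulLeftCLM ℂ fun x => Complex.exp (g₂ x * Complex.I)).toLinearMap
          = (LinearMap.id : 𝓢(Conf d, ℂ) →ₗ[ℂ] 𝓢(Conf d, ℂ)) := by
    intro g₁ g₂ h₁ h₂ h₁₂
    ext f x
    simp [smulLeftCLM_apply_apply (h g₁ h₁), smulLeftCLM_apply_apply (h g₂ h₂), ← mul_assoc, h₁₂]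
  LinearEquiv.ofLinearMap
    (smulLeftCLM ℂ fun x => Complex.exp (g x * Complex.I)).toLinearMap
    (smulLeftCLM ℂ fun x => Complex.exp ((-g x : ℝ) * Complex.I)).toLinearMap
    (hinv g _ hg hg.fun_neg fun _ => by simp [← Complex.exp_add])
    (hinv _ g hg.fun_neg hg fun _ => by simp [← Complex.exp_add])

theorem phaseMul_apply (g : Conf d → ℝ) (hg : g.HasTemperateGrowth) (f : 𝓢(Conf d, ℂ))
    (x : Conf d) : phaseMul g hg f x = Complex.exp (g x * Complex.I) * f x :=
  smulLeftCLM_apply_apply (hasTemperateGrowth_cexp_ofReal_mul_I.comp hg) f x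

theorem zhat_inr_apply_fderiv (j : Fin d) (f : 𝓢(Conf d, ℂ)) (x : Conf d) :
    zhat ħ (Sum.inr j) f x = -Complex.I * ħ * fderiv ℝ f x (EuclideanSpace.single j (1 : ℝ)) := by
  rw [zhat_inr_apply, f.differentiableAt.lineDeriv_eq_fderiv]

/-- Product rule: conjugation by the phase `exp(ig)` shifts the momentum by `ħ ∇g`. -/
theorem zhat_inr_phaseMul (g : Conf d → ℝ) (hg : g.HasTemperateGrowth) (j : Fin d)
    (f : 𝓢(Conf d, ℂ)) (x : Conf d) :
    zhat ħ (Sum.inr j) (phaseMul g hg f) x = Complex.exp (g x * Complex.I) *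
      (zhat ħ (Sum.inr j) f x +
        ħ * (fderiv ℝ g x (EuclideanSpace.single j (1 : ℝ)) : ℝ) * f x) := by
  have hgd : HasFDerivAt g (fderiv ℝ g x) x :=
    ((hg.1.differentiable (by simp)) x).hasFDerivAt
  have h1 : HasFDerivAt (fun y => (g y : ℂ) * Complex.I)
      (Complex.I • (Complex.ofRealCLM ∘L fderiv ℝ g x)) x :=
    (Complex.ofRealCLM.hasFDerivAt.comp x hgd).mul_const Complex.I
  have h2 := h1.cexp.fun_mul (f.hasFDerivAt x)
  have e : (phaseMul g hg f : Conf d → ℂ) = fun y => Complex.exp (g y * Complex.I) * f y :=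
    funext (phaseMul_apply g hg f)
  rw [zhat_inr_apply_fderiv, zhat_inr_apply_fderiv, e, h2.fderiv]
  simp
  linear_combination (-Complex.exp (g x * Complex.I) * f x * ħ *
    (fderiv ℝ g x (EuclideanSpace.single j (1 : ℝ)) : ℝ)) * Complex.I_mul_I

theorem hasTemperateGrowth_coord (j : Fin d) : (fun x : Conf d => x j).HasTemperateGrowth :=
  (EuclideanSpace.proj j : Conf d →L[ℝ] ℝ).hasTemperateGrowth

/-- The phase is `g = xᵀRx / 2ħ`, so the momentum shift `ħ ∇g` is `Rx`, while positions commute with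
the phase. -/
theorem implements_opV (hħ : 0 < ħ) (R : Matrix (Fin d) (Fin d) ℝ) (hR : R.IsSymm) :
    Implements ħ (opV ħ R) (spV R hR).1 0 := by
  have hg : (fun x : Conf d => (∑ i, ∑ l, R i l * (x i * x l)) / (2 * ħ)).HasTemperateGrowth := by
    simp only [div_eq_mul_inv]
    refine Function.HasTemperateGrowth.mul (.sum fun i _ => .sum fun l _ => ?_) (.const _)
    exact .mul (.const _) ((hasTemperateGrowth_coord i).mul (hasTemperateGrowth_coord l))
  have hd : ∀ (x : Conf d) (j : Fin d),
      ħ * fderiv ℝ (fun x : Conf d => (∑ i, ∑ l, R i l * (x i * x l)) / (2 * ħ)) x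
        (EuclideanSpace.single j (1 : ℝ)) = ∑ l, R j l * x l := by
    intro x j
    have hc : ∀ i, HasFDerivAt (fun x : Conf d => x i)
        (EuclideanSpace.proj i : Conf d →L[ℝ] ℝ) x :=
      fun i => (EuclideanSpace.proj i : Conf d →L[ℝ] ℝ).hasFDerivAt
    have h := (HasFDerivAt.fun_sum (u := Finset.univ) fun i _ =>
      HasFDerivAt.fun_sum (u := Finset.univ) fun l _ =>
        ((hc i).fun_mul (hc l)).const_mul (R i l)).mul_const (2 * ħ)⁻¹
    simp only [div_eq_mul_inv]
    rw [h.fderiv]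
    -- Differentiating the quadratic form produces both `R x` and `Rᵀ x`; symmetry merges them and
    -- cancels the factor `1/2`.
    have hs : ∑ l, R l j * x l = ∑ l, R j l * x l :=
      Finset.sum_congr rfl fun l _ => by rw [hR.apply]
    simp [Finset.sum_add_distrib, mul_add, hs]
    field_simp
    ring
  refine ⟨phaseMul _ hg, fun f => ?_, ?_⟩
  · apply weightedComp_schwartzToL2
    intro x
    rw [phaseMul_apply]
    congr 2
    simp only [dotProduct, Matrix.mulVec, Finset.mul_sum]
    push_cast
    rw [div_mul_eq_mul_div, mul_comm _ Complex.I, mul_div_right_comm]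
    congr 1
    refine Finset.sum_congr rfl fun i _ => Finset.sum_congr rfl fun l _ => ?_
    ring
  · rintro (j | j) f
    · ext x
      simp [spV, zhat_inl_apply, phaseMul_apply, Matrix.one_apply]
      ring
    · ext x
      rw [zhat_inr_phaseMul, phaseMul_apply, ← Complex.ofReal_mul, hd]
      simp [spV, zhat_inl_apply, Matrix.one_apply, Finset.sum_mul, mul_assoc, add_comm]

/-- Translation by `q` shifts positions by `q`. The phase has `ħ ∇g = p` and shifts momenta by `p`;
its term in `q/2` is constant in `x` and drops out of the gradient. -/
theorem implements_heisenbergWeyl (hħ : 0 < ħ) (z : Phase d) :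
    Implements ħ (heisenbergWeyl ħ z) 1 z := by
  let q : Conf d := WithLp.toLp 2 fun j => z (Sum.inl j)
  have hg : (fun x : Conf d =>
      (∑ j, z (Sum.inr j) * (x j - z (Sum.inl j) / 2)) / ħ).HasTemperateGrowth := by
    simp only [div_eq_mul_inv _ ħ]
    refine Function.HasTemperateGrowth.mul (.sum fun i _ => ?_) (.const _)
    exact .mul (.const _) ((hasTemperateGrowth_coord i).sub (.const _))
  have hd : ∀ (x : Conf d) (j : Fin d),
      ħ * fderiv ℝ (fun x : Conf d => (∑ j, z (Sum.inr j) * (x j - z (Sum.inl j) / 2)) / ħ) x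
        (EuclideanSpace.single j (1 : ℝ)) = z (Sum.inr j) := by
    intro x j
    have hc : ∀ i, HasFDerivAt (fun x : Conf d => x i)
        (EuclideanSpace.proj i : Conf d →L[ℝ] ℝ) x :=
      fun i => (EuclideanSpace.proj i : Conf d →L[ℝ] ℝ).hasFDerivAt
    have h := (HasFDerivAt.fun_sum (u := Finset.univ) fun i _ =>
        ((hc i).sub_const (z (Sum.inl i) / 2)).const_mul (z (Sum.inr i))).mul_const ħ⁻¹
    simp only [div_eq_mul_inv _ ħ]
    rw [h.fderiv]
    simp
    field_simp
  let τ : 𝓢(Conf d, ℂ) ≃ₗ[ℂ] 𝓢(Conf d, ℂ) := LinearEquiv.ofLinearMap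
    (compSubConstCLM ℂ q).toLinearMap (compSubConstCLM ℂ (-q)).toLinearMap
    (by ext f x; simp)
    (by ext f x; simp)
  have hτ : ∀ f x, τ f x = f (x - q) := fun f x => compSubConstCLM_apply ..
  refine ⟨τ.trans (phaseMul _ hg), fun f => ?_, ?_⟩
  · apply weightedComp_schwartzToL2
    intro x
    rw [LinearEquiv.trans_apply, phaseMul_apply, hτ]
    congr 2
    push_cast
    ring
  · rintro (j | j) f
    · ext x
      simp [zhat_inl_apply, phaseMul_apply, Matrix.one_apply, hτ]
      simp [q]
      ring
    · ext x
      have e : (τ f : Conf d → ℂ) = fun y => f (y - q) := funext (hτ f)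
      rw [LinearEquiv.trans_apply, LinearEquiv.trans_apply, zhat_inr_phaseMul, phaseMul_apply,
        ← Complex.ofReal_mul, hd, hτ, hτ, zhat_inr_apply_fderiv, e, fderiv_comp_sub]
      simp [zhat_inr_apply_fderiv, Matrix.one_apply]

/-! ### Linear changes of variables -/

/-- The continuous linear equivalence `x ↦ L x` of `ℝᵈ`. -/
def glEquiv (L : GL (Fin d) ℝ) : Conf d ≃L[ℝ] Conf d :=
  { glHomeo L with
    map_add' := map_add (Matrix.toEuclideanLin L.1)
    map_smul' := map_smul (Matrix.toEuclideanLin L.1) }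

/-- Composition of Schwartz functions with a continuous linear equivalence. -/
def compEquiv (e : Conf d ≃L[ℝ] Conf d) : 𝓢(Conf d, ℂ) ≃ₗ[ℂ] 𝓢(Conf d, ℂ) :=
  LinearEquiv.ofLinearMap (compCLMOfContinuousLinearEquiv ℂ e).toLinearMap
    (compCLMOfContinuousLinearEquiv ℂ e.symm).toLinearMap
    (by ext f x; simp)
    (by ext f x; simp)

theorem compEquiv_apply (e : Conf d ≃L[ℝ] Conf d) (f : 𝓢(Conf d, ℂ)) (x : Conf d) :
    compEquiv e f x = f (e x) := rfl

/-- Chain rule: the derivative of `f ∘ e` along a basis vector is that of `f` along its image under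
`e`, expanded in the standard basis. -/
theorem zhat_inr_compEquiv (e : Conf d ≃L[ℝ] Conf d) (f : 𝓢(Conf d, ℂ)) (x : Conf d) (j : Fin d) :
    zhat ħ (Sum.inr j) (compEquiv e f) x =
      ∑ l, (e (EuclideanSpace.single j 1) l : ℂ) * zhat ħ (Sum.inr l) f (e x) := by
  have h : (compEquiv e f : Conf d → ℂ) = f ∘ e := rfl
  rw [zhat_inr_apply_fderiv, h, e.comp_right_fderiv]
  simp only [zhat_inr_apply_fderiv]
  have hs : e (EuclideanSpace.single j 1) = ∑ l, e (EuclideanSpace.single j 1) l •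
      (EuclideanSpace.single l (1 : ℝ) : Conf d) := by
    ext i; simp [Pi.single_apply]
  rw [ContinuousLinearMap.comp_apply, ContinuousLinearEquiv.coe_coe]
  conv_lhs => rw [hs]
  rw [map_sum, Finset.mul_sum]
  refine Finset.sum_congr rfl fun l _ => ?_
  rw [map_smul, Complex.real_smul]
  ring

/-- The constant weight commutes with `ẑ`, so only the substitution `y = L x` matters: positions
become `x = L⁻¹ y` and the chain rule turns momenta into `Lᵀ p̂`. -/
theorem implements_opM (L : GL (Fin d) ℝ) (m : ℤ) : Implements ħ (opM L m) (spM L).1 0 := by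
  have hw : (Complex.I ^ m * (√|L.1.det| : ℝ) : ℂ) ≠ 0 :=
    mul_ne_zero (zpow_ne_zero _ Complex.I_ne_zero) (Complex.ofReal_ne_zero.2
      (Real.sqrt_pos.2 (abs_pos.2 (Matrix.GeneralLinearGroup.det_ne_zero L))).ne')
  refine ⟨(compEquiv (glEquiv L)).trans (LinearEquiv.smulOfNeZero ℂ _ _ hw), fun f => ?_, ?_⟩
  · apply weightedComp_schwartzToL2
    intro x
    rfl
  · rintro (j | j) f
    · ext x
      have h : ∑ l, ((L⁻¹).1 j l : ℂ) * (glEquiv L x l : ℂ) = x j := by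
        have : (L⁻¹).1 *ᵥ (L.1 *ᵥ x.ofLp) = x.ofLp := by simp
        exact_mod_cast congrFun this j
      simp [spM, zhat_inl_apply, compEquiv_apply, ← h, Finset.sum_mul, Finset.mul_sum, mul_assoc,
        mul_left_comm]
    · ext x
      have h : ∀ l, glEquiv L (EuclideanSpace.single j 1) l = L.1 l j := by
        intro l
        change Matrix.toEuclideanLin L.1 (EuclideanSpace.single j 1) l = _
        simp [Matrix.toLpLin_apply]
      simp [spM, zhat_inr_compEquiv, compEquiv_apply, h, Finset.mul_sum]

/-! ### The Fourier transform -/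

/-- Under the kernel `exp(-2πi x · y)` the derivative `∂_j` becomes multiplication by `2πi x_j`, and
`-iħ · 2πi = 2πħ`. -/
theorem fourier_zhat_inr (j : Fin d) (f : 𝓢(Conf d, ℂ)) (x : Conf d) :
    𝓕 (zhat ħ (Sum.inr j) f) x = 2 * Real.pi * ħ * (x j * 𝓕 f x) := by
  have h : (inner ℝ · (EuclideanSpace.single j (1 : ℝ)) : Conf d → ℝ).HasTemperateGrowth := by
    fun_prop
  have hi : ∀ y : Conf d, inner ℝ y (EuclideanSpace.single j (1 : ℝ)) = y j := fun y => by
    simp [EuclideanSpace.inner_single_right]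
  have e : zhat ħ (Sum.inr j) f
      = (-(Complex.I * ħ)) • ∂_{(EuclideanSpace.single j (1 : ℝ) : Conf d)} f := rfl
  rw [e, FourierTransform.fourier_smul, fourier_lineDerivOp_eq]
  simp [smulLeftCLM_apply_apply h]
  rw [hi]
  linear_combination (-(2 * Real.pi * ħ * (x j * 𝓕 f x))) * Complex.I_mul_I

/-- Here `∂_j 𝓕 f` is the transform of `-2πi x_j f`, and `-iħ · (-2πi) = -2πħ`. -/
theorem zhat_inr_fourier (j : Fin d) (f : 𝓢(Conf d, ℂ)) (x : Conf d) :
    zhat ħ (Sum.inr j) (𝓕 f) x = -(2 * Real.pi * ħ) * 𝓕 (zhat ħ (Sum.inl j) f) x := by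
  have h : (inner ℝ · (EuclideanSpace.single j (1 : ℝ)) : Conf d → ℝ).HasTemperateGrowth := by
    fun_prop
  have hi : ∀ y : Conf d, inner ℝ y (EuclideanSpace.single j (1 : ℝ)) = y j := fun y => by
    simp [EuclideanSpace.inner_single_right]
  have e : zhat ħ (Sum.inr j) (𝓕 f)
      = (-(Complex.I * ħ)) • ∂_{(EuclideanSpace.single j (1 : ℝ) : Conf d)} (𝓕 f) := rfl
  have e' : smulLeftCLM ℂ (inner ℝ · (EuclideanSpace.single j (1 : ℝ)) : Conf d → ℝ) f
      = zhat ħ (Sum.inl j) f := by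
    ext y
    rw [smulLeftCLM_apply_apply h, zhat_inl_apply, hi, Complex.real_smul]
  rw [e, lineDerivOp_fourier_eq, e', FourierTransform.fourier_smul]
  simp
  linear_combination ((2 * Real.pi * ħ * 𝓕 (zhat ħ (Sum.inl j) f) x)) * Complex.I_mul_I

/-- The dilation by `(2πħ)⁻¹` absorbs the factors `±2πħ` of the two exchange rules and leaves `x̂ ↦
p̂`, `p̂ ↦ -x̂`, the rows of `J`. The constant prefactor commutes with `ẑ`. -/
theorem implements_opJ (hħ : 0 < ħ) : Implements ħ (opJ (d := d) hħ) (spJ d).1 0 := by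
  have hpos : 0 < 2 * Real.pi * ħ := by positivity
  let e : Conf d ≃L[ℝ] Conf d :=
    ContinuousLinearEquiv.smulLeft (Units.mk0 (2 * Real.pi * ħ)⁻¹ (inv_ne_zero hpos.ne'))
  have he : ∀ x, e x = (2 * Real.pi * ħ)⁻¹ • x := fun x => rfl
  let w : ℂ := ((2 * Real.pi * ħ * Complex.I : ℂ) ^ ((d : ℂ) / 2))⁻¹
  have hw : w ≠ 0 := by
    rw [← norm_ne_zero_iff, norm_opJ_weight hħ]
    positivity
  refine ⟨((FourierTransform.fourierEquiv ℂ 𝓢(Conf d, ℂ)).trans (compEquiv e)).trans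
    (LinearEquiv.smulOfNeZero ℂ _ _ hw), fun f => ?_, ?_⟩
  · have h1 : (Lp.fourierTransformₗᵢ (Conf d) ℂ) (schwartzToL2 d f) = schwartzToL2 d (𝓕 f) :=
      SchwartzMap.toLp_fourier_eq f
    refine (congrArg (rescale hħ) h1).trans ?_
    apply weightedComp_schwartzToL2
    intro x
    rfl
  · have hc : (2 * Real.pi * ħ : ℂ) * (2 * Real.pi * ħ : ℂ)⁻¹ = 1 :=
      mul_inv_cancel₀ (by exact_mod_cast hpos.ne')
    rintro (j | j) f
    · have hs : ∑ l, ((spJ d).1 (Sum.inl j) l : ℂ) • zhat ħ l f +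
          (((0 : Phase d) (Sum.inl j) : ℝ) : ℂ) • f
          = zhat ħ (Sum.inr j) f := by
        simp [spJ, matJ, Matrix.one_apply]
      rw [hs]
      ext x
      change w * 𝓕 (zhat ħ (Sum.inr j) f) (e x) = _
      rw [fourier_zhat_inr, zhat_inl_apply, he]
      change _ = x j * (w * 𝓕 f (e x))
      rw [he]
      simp only [PiLp.smul_apply, smul_eq_mul]
      push_cast
      linear_combination (w * x j * 𝓕 f ((2 * Real.pi * ħ)⁻¹ • x)) * hc
    · have hs : ∑ l, ((spJ d).1 (Sum.inr j) l : ℂ) • zhat ħ l f +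
          (((0 : Phase d) (Sum.inr j) : ℝ) : ℂ) • f
          = -zhat ħ (Sum.inl j) f := by
        simp [spJ, matJ, Matrix.one_apply]
      rw [hs, map_neg]
      ext x
      change -(w * 𝓕 (zhat ħ (Sum.inl j) f) (e x))
        = zhat ħ (Sum.inr j) (w • compEquiv e (𝓕 f)) x
      rw [map_smul]
      change _ = w * zhat ħ (Sum.inr j) (compEquiv e (𝓕 f)) x
      -- The dilation is a scalar matrix, so only the term `l = j` of the chain rule survives, with
      -- coefficient `(2πħ)⁻¹`.
      rw [zhat_inr_compEquiv, Finset.sum_eq_single j (fun l _ hl => by simp [he, hl]) (by simp),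
        zhat_inr_fourier, he, he]
      simp only [PiLp.smul_apply, PiLp.single_apply, if_true, smul_eq_mul, mul_one]
      push_cast
      linear_combination (w * 𝓕 (zhat ħ (Sum.inl j) f) ((2 * Real.pi * ħ)⁻¹ • x)) * hc

/-! ### The metaplectic group and covariance -/

/-- The induction runs over pairs in the graph of the projection, so the matrix is carried along
with the operator and the projection need not be known to be single-valued. -/
theorem implements_of_isOver (hħ : 0 < ħ) {V : U d} {S : Sp d} (h : IsOver hħ V S) :
    Implements ħ V S.1 0 := by
  refine Subgroup.closure_induction (p := fun g _ => Implements ħ g.1 g.2.1 0) ?_ ?_ ?_ ?_ h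
  · rintro _ (_ | ⟨R, hR⟩ | ⟨L, m, hm⟩)
    · exact implements_opJ hħ
    · exact implements_opV hħ R hR
    · exact implements_opM L m
  · exact implements_one
  · intro g g' _ _ h h'
    simpa using h.mul h'
  · intro g _ h
    exact h.inv (congrArg Subtype.val (inv_mul_cancel g.2))

theorem conj_ladder (hħ : 0 < ħ) (V : U d) (S₀ : Sp d) (hV : IsOver hħ V S₀) (S : Sp d)
    (z : Phase d) (j : Fin d ⊕ Fin d) :
    conj V (ladder hħ S z j) = ladder hħ (S₀ * S) (S₀.1 *ᵥ z) j := by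
  have h1 := (implements_of_isOver hħ hV).mul ((implements_heisenbergWeyl hħ z).mul
    (implements_of_isOver hħ (isOver_lift hħ S)))
  have h2 := (implements_heisenbergWeyl hħ (S₀.1 *ᵥ z)).mul
    (implements_of_isOver hħ (isOver_lift hħ (S₀ * S)))
  -- Both products now implement the linear part `S₀ S` with translation `S₀ z`.
  simp only [Matrix.one_mul, Matrix.mulVec_zero, zero_add, add_zero] at h1 h2
  -- Iterated conjugations agree by definition with conjugation by the product, domains included.
  exact h1.conj_schwartzOp_rho_eq (congrArg Subtype.val (inv_mul_cancel (S₀ * S))) h2 _ j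

end Hagedorn

end

theorem mainTheorem7 {d : ℕ} {ħ : ℝ} (hħ : 0 < ħ) (S₀hat : Hagedorn.U d) (S₀ : Hagedorn.Sp d)
    (hS₀ : Hagedorn.IsOver hħ S₀hat S₀) (S : Hagedorn.Sp d) (z : Hagedorn.Phase d) (j : Fin d) :
    Hagedorn.conj S₀hat (Hagedorn.lowering hħ S z j)
        = Hagedorn.lowering hħ (S₀ * S) (S₀.1 *ᵥ z) j ∧
      Hagedorn.conj S₀hat (Hagedorn.raising hħ S z j)
        = Hagedorn.raising hħ (S₀ * S) (S₀.1 *ᵥ z) j :=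
  ⟨Hagedorn.conj_ladder hħ S₀hat S₀ hS₀ S z _, Hagedorn.conj_ladder hħ S₀hat S₀ hS₀ S z _⟩
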